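/- For $\tau$ in the upper half-plane let $X_\tau=\mathbb C/\Lambda_\tau$ with $\Lambda_\tau=\mathbb Z+\mathbb Z\tau$; it is a Riemann surface of genus $1$, and $\tau$ is considered modulo the action of $\mathrm{SL}_2(\mathbb Z)$. A complex affine (resp. projective) structure is a maximal atlas of charts with values in $\mathbb C$ (resp. $\mathbb{CP}^1$) whose transition functions are locally restrictions of maps $z\mapsto az+b$, $a\neq0$ (resp. of Möbius transformations). Let $\mathcal A(X_\tau)$ be the set of complex affine structures on $X_\tau$ whose underlying complex structure is that of $X_\tau$; the Euclidean uniformization is the one whose atlas is generated by the local inverses of $\mathbb C\to X_\tau$. Every $\sigma\in\mathcal A(X_\tau)$ is regarded as a complex projective structure via $\mathbb C\subset\mathbb{CP}^1$, and $\sigma$ is called a relatively Hurwitz projective structure if the group of homeomorphisms of $X_\tau$ that are given locally by Möbius transformations in its projective charts is equal to the group $\mathrm{Aut}(X_\tau)$ of holomorphic automorphisms of $X_\tau$. For every $\tau$ the following are equivalent: 1. the class of $\tau$ modulo $\mathrm{SL}_2(\mathbb Z)$ is the class of $e^{2\pi i/3}$ or of $e^{i\pi/2}$; 2. the Euclidean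 uniformization of $X_\tau$ is relatively Hurwitz, and it is the unique relatively Hurwitz projective structure in $\mathcal A(X_\tau)$; 3. $X_\tau$ has an extra automorphism given by complex multiplication, i.e. there are $a\in\mathbb C\setminus\{1,-1\}$ and $f\in\mathrm{Aut}(X_\tau)$ with $f([z])=[az]$ for all $z\in\mathbb C$. -/

import Mathlib

open Set Filter Topology Manifold ContDiff

noncomputable section

namespace Unif

/-! ### Maximal atlases -/

section GStructure

variable {H : Type*} [TopologicalSpace H]

/-- The pseudogroup on `H` of all local homeomorphisms that agree, near every point of their
source, with an element of the transformation group `Γ`. -/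
def localGroupoid (Γ : Subgroup (Equiv.Perm H)) : StructureGroupoid H where
  members := {e | ∀ x ∈ e.source, ∃ g ∈ Γ, ∀ᶠ y in 𝓝 x, e y = g y}
  trans' := by
    intro e e' he he' x hx
    rw [OpenPartialHomeomorph.trans_source] at hx
    obtain ⟨g, hg, h⟩ := he x hx.1
    obtain ⟨g', hg', h'⟩ := he' (e x) hx.2
    refine ⟨g' * g, mul_mem hg' hg, ?_⟩
    filter_upwards [h, (e.continuousAt hx.1).eventually h'] with y hy hy'
    simp only [OpenPartialHomeomorph.coe_trans, Function.comp_apply, Equiv.Perm.mul_apply]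
    rw [hy', hy]
  symm' := by
    intro e he x hx
    have hx' : x ∈ e.target := hx
    obtain ⟨g, hg, h⟩ := he (e.symm x) (e.map_target hx')
    refine ⟨g⁻¹, inv_mem hg, ?_⟩
    filter_upwards [(e.symm.continuousAt hx).eventually h, e.open_target.mem_nhds hx'] with y hy hy'
    rw [e.right_inv hy'] at hy
    exact (Equiv.Perm.inv_eq_iff_eq.2 hy).symm
  id_mem' := fun x _ => ⟨1, one_mem _, by simp⟩
  locality' := by
    intro e h x hx
    obtain ⟨s, hs, hxs, h'⟩ := h x hx
    exact h' x (by rw [e.restr_source' s hs]; exact ⟨hx, hxs⟩)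
  mem_of_eqOnSource' := by
    intro e e' he hee' x hx
    obtain ⟨g, hg, h⟩ := he x (hee'.1 ▸ hx)
    refine ⟨g, hg, ?_⟩
    filter_upwards [h, e'.open_source.mem_nhds hx] with y hy hy'
    rw [hee'.2 hy', hy]

/-- A geometric structure on `X` modelled on the pseudogroup `G`: a maximal atlas of charts with
values in `H` whose transition functions belong to `G`. -/
@[ext]
structure GStructure (G : StructureGroupoid H) (X : Type*) [TopologicalSpace X] where
  charts : Set (OpenPartialHomeomorph X H)
  cover : ∀ x : X, ∃ e ∈ charts, x ∈ e.source
  compatible : ∀ e ∈ charts, ∀ e' ∈ charts, e.symm ≫ₕ e' ∈ G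
  maximal : ∀ e : OpenPartialHomeomorph X H, (∀ e' ∈ charts, e'.symm ≫ₕ e ∈ G) → e ∈ charts

variable {X : Type*} [TopologicalSpace X]

/-- The unique structure whose maximal atlas contains the given atlas `A`. -/
def GStructure.generate (G : StructureGroupoid H) (A : Set (OpenPartialHomeomorph X H))
    (cover : ∀ x : X, ∃ e ∈ A, x ∈ e.source)
    (compatible : ∀ e ∈ A, ∀ e' ∈ A, e.symm ≫ₕ e' ∈ G) : GStructure G X where
  charts := {e | ∀ e' ∈ A, e'.symm ≫ₕ e ∈ G}
  cover := fun x => by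
    obtain ⟨e, he, hx⟩ := cover x
    exact ⟨e, fun e' he' => compatible e' he' e he, hx⟩
  compatible := by
    intro e he e' he'
    let inst : ChartedSpace H X :=
      { atlas := A
        chartAt := fun x => (cover x).choose
        mem_chart_source := fun x => (cover x).choose_spec.2
        chart_mem_atlas := fun x => (cover x).choose_spec.1 }
    have key : ∀ c : OpenPartialHomeomorph X H, (∀ c' ∈ A, c'.symm ≫ₕ c ∈ G) →
        c ∈ G.maximalAtlas X := by
      intro c hc c' hc'
      have h := hc c' hc'
      have h2 := G.symm h
      rw [OpenPartialHomeomorph.trans_symm_eq_symm_trans_symm,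
        OpenPartialHomeomorph.symm_symm] at h2
      exact ⟨h2, h⟩
    exact StructureGroupoid.compatible_of_mem_maximalAtlas (key e he) (key e' he')
  maximal := fun e h e' he' => h e' fun e'' he'' => compatible e'' he'' e' he'

/-- The group of automorphisms of a geometric structure: the homeomorphisms of `X` which, read in
the charts of the structure, belong to the pseudogroup. -/
def GStructure.aut {G : StructureGroupoid H} (σ : GStructure G X) : Subgroup (X ≃ₜ X) where
  carrier := {f | ∀ e ∈ σ.charts, ∀ e' ∈ σ.charts,
    e.symm ≫ₕ f.toOpenPartialHomeomorph ≫ₕ e' ∈ G}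
  one_mem' := by
    intro e he e' he'
    change e.symm ≫ₕ OpenPartialHomeomorph.refl X ≫ₕ e' ∈ G
    rw [OpenPartialHomeomorph.refl_trans]
    exact σ.compatible e he e' he'
  mul_mem' := by
    intro f g hf hg
    let inst : ChartedSpace H X :=
      { atlas := σ.charts
        chartAt := fun x => (σ.cover x).choose
        mem_chart_source := fun x => (σ.cover x).choose_spec.2
        chart_mem_atlas := fun x => (σ.cover x).choose_spec.1 }
    let F : Structomorph G X X := ⟨f, fun c c' hc hc' => hf c hc c' hc'⟩
    let K : Structomorph G X X := ⟨g, fun c c' hc hc' => hg c hc c' hc'⟩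
    intro e he e' he'
    exact (K.trans F).mem_groupoid e e' he he'
  inv_mem' := by
    intro f hf e he e' he'
    have h := G.symm (hf e' he' e he)
    rw [OpenPartialHomeomorph.trans_symm_eq_symm_trans_symm,
      OpenPartialHomeomorph.trans_symm_eq_symm_trans_symm, OpenPartialHomeomorph.symm_symm,
      OpenPartialHomeomorph.trans_assoc] at h
    exact h

end GStructure

/-! ### Affine and projective structures -/

/-- The group of affine transformations `z ↦ a z + b` of `ℂ`, with `a ≠ 0`. -/
def affineGroup : Subgroup (Equiv.Perm ℂ) where
  carrier := {g | ∃ a b : ℂ, a ≠ 0 ∧ ∀ z, g z = a * z + b}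
  one_mem' := ⟨1, 0, one_ne_zero, by simp⟩
  mul_mem' := by
    rintro f g ⟨a, b, ha, hf⟩ ⟨c, d, hc, hg⟩
    refine ⟨a * c, a * d + b, mul_ne_zero ha hc, fun z => ?_⟩
    rw [Equiv.Perm.mul_apply, hg, hf]
    ring
  inv_mem' := by
    rintro f ⟨a, b, ha, hf⟩
    refine ⟨a⁻¹, -a⁻¹ * b, inv_ne_zero ha, fun z => ?_⟩
    rw [Equiv.Perm.inv_eq_iff_eq, hf]
    field_simp
    ring

/-- The Riemann sphere `ℂ ∪ {∞}`. -/
abbrev Sphere : Type := OnePoint ℂ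

/-- The group of Möbius transformations of the Riemann sphere, i.e. the image of `GL₂(ℂ)`, which
is also the image of `SL₂(ℂ)` and is isomorphic to `PSL₂(ℂ)`. -/
def moebiusGroup : Subgroup (Equiv.Perm Sphere) :=
  (MulAction.toPermHom (GL (Fin 2) ℂ) Sphere).range

/-- A complex affine structure. -/
abbrev AffineStructure (X : Type*) [TopologicalSpace X] : Type _ :=
  GStructure (localGroupoid affineGroup) X

/-- A complex projective structure. -/
abbrev ProjectiveStructure (X : Type*) [TopologicalSpace X] : Type _ :=
  GStructure (localGroupoid moebiusGroup) X

/-- The affine patch `ℂ ⊆ ℂ ∪ {∞}`. -/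
def patch : OpenPartialHomeomorph ℂ Sphere :=
  (OnePoint.isOpenEmbedding_coe (X := ℂ)).toOpenPartialHomeomorph _

/-- Every affine transformation extends to a Möbius transformation. -/
theorem exists_moebius_of_affine {g : Equiv.Perm ℂ} (hg : g ∈ affineGroup) :
    ∃ m ∈ moebiusGroup, ∀ z : ℂ, m (z : Sphere) = (g z : ℂ) := by
  obtain ⟨a, b, ha, h⟩ := hg
  let M : GL (Fin 2) ℂ := Matrix.GeneralLinearGroup.mkOfDetNeZero !![a, b; 0, 1] (by simpa)
  refine ⟨_, ⟨M, rfl⟩, fun z => ?_⟩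
  rw [MulAction.toPermHom_apply, MulAction.toPerm_apply, OnePoint.smul_some_eq_ite, h]
  simp [M, Matrix.GeneralLinearGroup.mkOfDetNeZero]

variable {X : Type*} [TopologicalSpace X]

/-- The projective structure underlying an affine structure: its maximal atlas is generated by the
affine charts, seen as charts with values in `ℂ ⊆ ℂ ∪ {∞}`. -/
def toProjective (σ : AffineStructure X) : ProjectiveStructure X :=
  GStructure.generate _ ((fun e => e ≫ₕ patch) '' σ.charts)
    (fun x => by
      obtain ⟨e, he, hx⟩ := σ.cover x
      exact ⟨_, ⟨e, he, rfl⟩, by simpa [patch] using hx⟩)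
    (by
      rintro _ ⟨e, he, rfl⟩ _ ⟨e', he', rfl⟩ x hx
      have hx1 : x ∈ patch.target := by
        simp only [OpenPartialHomeomorph.trans_source, OpenPartialHomeomorph.symm_source,
          OpenPartialHomeomorph.trans_target] at hx
        exact hx.1.1
      obtain ⟨z, -, rfl⟩ := patch.image_source_eq_target ▸ hx1
      have hz : patch.symm (patch z) = z := patch.left_inv (by simp [patch])
      have hze : z ∈ (e.symm ≫ₕ e').source := by
        simp only [OpenPartialHomeomorph.trans_source, OpenPartialHomeomorph.symm_source,
          mem_inter_iff, mem_preimage,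
          OpenPartialHomeomorph.trans_symm_eq_symm_trans_symm,
          OpenPartialHomeomorph.coe_trans, Function.comp_apply, hz] at hx ⊢
        exact ⟨hx.1.2, hx.2.1⟩
      obtain ⟨g, hg, h⟩ := σ.compatible e he e' he' z hze
      obtain ⟨m, hm, hmg⟩ := exists_moebius_of_affine hg
      refine ⟨m, hm, ?_⟩
      have hnhds : 𝓝 (patch z) = Filter.map patch (𝓝 z) :=
        (patch.map_nhds_eq (by simp [patch])).symm
      rw [hnhds, Filter.eventually_map]
      filter_upwards [h] with w hw
      have hw' : patch.symm (patch w) = w := patch.left_inv (by simp [patch])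
      simp only [OpenPartialHomeomorph.trans_symm_eq_symm_trans_symm,
        OpenPartialHomeomorph.coe_trans, Function.comp_apply, hw'] at hw ⊢
      rw [hw]
      exact (hmg w).symm)

/-- The group of projective automorphisms of a projective structure. -/
abbrev moeb (σ : ProjectiveStructure X) : Subgroup (X ≃ₜ X) := σ.aut

/-! ### Riemann surfaces -/

/-- The group of holomorphic automorphisms of a Riemann surface. -/
def holAut (X : Type*) [TopologicalSpace X] [ChartedSpace ℂ X] : Subgroup (X ≃ₜ X) where
  carrier := {f | MDifferentiable 𝓘(ℂ) 𝓘(ℂ) f ∧ MDifferentiable 𝓘(ℂ) 𝓘(ℂ) f.symm}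
  one_mem' := ⟨mdifferentiable_id, mdifferentiable_id⟩
  mul_mem' := fun {_ _} hf hg => ⟨hf.1.comp hg.1, hg.2.comp hf.2⟩
  inv_mem' := fun {_} hf => ⟨hf.2, hf.1⟩

/-- The space `𝒜(X)` of complex affine structures on the Riemann surface `X`: those whose charts
are holomorphic charts of `X`, so that the underlying complex structure is that of `X`. -/
def affineStructures (X : Type*) [TopologicalSpace X] [ChartedSpace ℂ X] :
    Set (AffineStructure X) :=
  {σ | σ.charts ⊆ IsManifold.maximalAtlas 𝓘(ℂ) ω X}

/-- A projective structure with underlying Riemann surface `X` is relatively Hurwitz if its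
projective automorphisms are exactly the holomorphic automorphisms of `X`. -/
def IsRelativelyHurwitz [ChartedSpace ℂ X] (σ : ProjectiveStructure X) : Prop :=
  moeb σ = holAut X

/-! ### The torus `X_τ = ℂ / (ℤ + ℤ τ)` -/

/-- The lattice `Λ_τ` spanned by `1` and `τ`. -/
def lattice (τ : UpperHalfPlane) : AddSubgroup ℂ := AddSubgroup.closure {1, (τ : ℂ)}

/-- The periods `1` and `τ`. -/
def periodPair (τ : UpperHalfPlane) : PeriodPair where
  ω₁ := 1
  ω₂ := τ
  indep := by
    rw [LinearIndependent.pair_iff]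
    intro s t h
    have him := congrArg Complex.im h
    have hre := congrArg Complex.re h
    have ht : t = 0 := by simpa [τ.im_ne_zero] using him
    subst ht
    exact ⟨by simpa using hre, rfl⟩

theorem lattice_eq (τ : UpperHalfPlane) : lattice τ = (periodPair τ).lattice.toAddSubgroup := by
  rw [PeriodPair.lattice, Submodule.span_int_eq_addSubgroupClosure]
  rfl

instance (τ : UpperHalfPlane) : DiscreteTopology (lattice τ) := by
  rw [lattice_eq]
  exact inferInstanceAs (DiscreteTopology (periodPair τ).lattice)

/-- The complex torus `X_τ = ℂ / Λ_τ`. -/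
abbrev Torus (τ : UpperHalfPlane) : Type := ℂ ⧸ lattice τ

/-- The quotient map `ℂ → X_τ`. -/
abbrev proj (τ : UpperHalfPlane) (z : ℂ) : Torus τ := (z : ℂ ⧸ lattice τ)

theorem isLocalHomeomorph_proj (τ : UpperHalfPlane) : IsLocalHomeomorph (proj τ) := by
  have h := AddSubgroup.isAddQuotientCoveringMap_of_comm (lattice τ)
    ⟨inferInstanceAs (DiscreteTopology (lattice τ))⟩
  exact h.isCoveringMap.isLocalHomeomorph

/-- The local inverses of the quotient map `ℂ → X_τ`. -/
def euclideanAtlas (τ : UpperHalfPlane) : Set (OpenPartialHomeomorph (Torus τ) ℂ) :=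
  {e | ⇑e.symm = proj τ}

theorem euclideanAtlas_cover (τ : UpperHalfPlane) (x : Torus τ) :
    ∃ e ∈ euclideanAtlas τ, x ∈ e.source := by
  obtain ⟨z, rfl⟩ := QuotientAddGroup.mk_surjective x
  obtain ⟨e, hz, he⟩ := isLocalHomeomorph_proj τ z
  refine ⟨e.symm, he.symm, ?_⟩
  have := e.map_source hz
  rwa [← he] at this

theorem euclideanAtlas_compatible (τ : UpperHalfPlane) :
    ∀ e ∈ euclideanAtlas τ, ∀ e' ∈ euclideanAtlas τ, ∀ z ∈ (e.symm ≫ₕ e').source,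
      ∃ b : ℂ, ∀ᶠ w in 𝓝 z, (e.symm ≫ₕ e') w = w + b := by
  intro e he e' he' z hz
  have hmem : ∀ w ∈ (e.symm ≫ₕ e').source, (e.symm ≫ₕ e') w - w ∈ lattice τ := by
    intro w hw
    rw [OpenPartialHomeomorph.trans_source] at hw
    have h1 : e'.symm (e' (e.symm w)) = e.symm w := e'.left_inv hw.2
    have h2 : proj τ (e' (e.symm w)) = proj τ w :=
      (congrFun he' _).symm.trans (h1.trans (congrFun he w))
    have h3 := QuotientAddGroup.eq.1 h2.symm
    rw [OpenPartialHomeomorph.coe_trans, Function.comp_apply, sub_eq_neg_add]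
    exact h3
  obtain ⟨U, hU, hU0⟩ : ∃ U ∈ 𝓝 (0 : ℂ), ∀ u ∈ U, u ∈ lattice τ → u = 0 := by
    have h : ({0} : Set (lattice τ)) ∈ 𝓝 0 := (isOpen_discrete _).mem_nhds rfl
    rw [nhds_subtype_eq_comap, Filter.mem_comap] at h
    obtain ⟨U, hU, h⟩ := h
    exact ⟨U, hU, fun u hu hl => congrArg Subtype.val (h (show (⟨u, hl⟩ : lattice τ).1 ∈ U from hu))⟩
  refine ⟨(e.symm ≫ₕ e') z - z, ?_⟩
  have hcont : Tendsto (fun w => ((e.symm ≫ₕ e') w - w) - ((e.symm ≫ₕ e') z - z)) (𝓝 z) (𝓝 0) := by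
    have h := (((e.symm ≫ₕ e').continuousAt hz).sub continuousAt_id).sub
      (continuousAt_const (y := (e.symm ≫ₕ e') z - z))
    have h' : Tendsto _ (𝓝 z) (𝓝 _) := h
    convert h' using 2 <;> simp
  filter_upwards [hcont hU, (e.symm ≫ₕ e').open_source.mem_nhds hz] with w hw hw'
  have h0 := hU0 _ hw (sub_mem (hmem w hw') (hmem z hz))
  linear_combination h0

/-- The complex structure of `X_τ`: the one for which the quotient map `ℂ → X_τ` is locally
biholomorphic. -/
instance (τ : UpperHalfPlane) : ChartedSpace ℂ (Torus τ) where
  atlas := euclideanAtlas τ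
  chartAt x := (euclideanAtlas_cover τ x).choose
  mem_chart_source x := (euclideanAtlas_cover τ x).choose_spec.2
  chart_mem_atlas x := (euclideanAtlas_cover τ x).choose_spec.1

instance (τ : UpperHalfPlane) : IsManifold 𝓘(ℂ) ω (Torus τ) :=
  isManifold_of_contDiffOn _ _ _ (by
    intro e e' he he'
    simp only [modelWithCornersSelf_coe, modelWithCornersSelf_coe_symm, Function.comp_id,
      Function.id_comp, preimage_id, range_id, inter_univ]
    intro z hz
    obtain ⟨b, hb⟩ := euclideanAtlas_compatible τ e he e' he' z hz
    exact ((contDiffAt_id.add contDiffAt_const).congr_of_eventuallyEq hb).contDiffWithinAt)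

/-- The Euclidean uniformization of `X_τ`: the affine structure coming from the identification
of `X_τ` with the quotient of `ℂ` by the group of translations `Λ_τ`. -/
def euclideanUniformization (τ : UpperHalfPlane) : AffineStructure (Torus τ) :=
  GStructure.generate _ (euclideanAtlas τ) (euclideanAtlas_cover τ) (by
    intro e he e' he' z hz
    obtain ⟨b, hb⟩ := euclideanAtlas_compatible τ e he e' he' z hz
    refine ⟨Equiv.addRight b, ⟨1, b, one_ne_zero, fun w => by simp⟩, ?_⟩
    filter_upwards [hb] with w hw
    simp [hw])

end Unif

end

/-!
Let `σ` be an affine structure on `X_τ` compatible with its complex structure. In the coordinate `z`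
of the universal cover `ℂ`, the quotient `φ'' / φ'` does not depend on the affine chart `φ` of `σ`;
it is entire and `Λ_τ`-periodic, hence a constant `c`. If `c = 0` then `σ` is the Euclidean
uniformization, otherwise `σ` is developed by `z ↦ exp (c z)`.

A holomorphic automorphism of `X_τ` lifts to `z ↦ u z + b` with `u Λ_τ = Λ_τ`. It is always affine
for the Euclidean uniformization. For the structure developed by `exp (c z)` it is projective if and
only if `exp (c (u z + b))` is a Möbius function of `exp (c z)`, which by linear independence of
exponentials means `u = ± 1`. So the Euclidean uniformization is the only relatively Hurwitz
structure if and only if `Λ_τ` has a unit `u ≠ ± 1`. Since the units of `Λ_τ` are the automorphy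
factors at `τ` of the elements of `SL₂(ℤ)` fixing `τ`, this means that `τ` is an elliptic point.
-/

noncomputable section

namespace Unif

section GStructure

variable {H X Y : Type*} [TopologicalSpace H] [TopologicalSpace X] [TopologicalSpace Y]

namespace GStructure

theorem eq_of_charts_subset {G : StructureGroupoid H} {σ σ' : GStructure G X}
    (h : σ.charts ⊆ σ'.charts) : σ = σ' :=
  GStructure.ext <| h.antisymm fun e he =>
    σ.maximal e fun e' he' => σ'.compatible e' (h he') e he

theorem subset_charts_generate {G : StructureGroupoid H} {A : Set (OpenPartialHomeomorph X H)}
    (cover : ∀ x : X, ∃ e ∈ A, x ∈ e.source) (compatible : ∀ e ∈ A, ∀ e' ∈ A, e.symm ≫ₕ e' ∈ G) :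
    A ⊆ (GStructure.generate G A cover compatible).charts :=
  fun e he e' he' => compatible e' he' e he

theorem generate_eq_of_subset_charts {G : StructureGroupoid H} {σ : GStructure G X}
    {A : Set (OpenPartialHomeomorph X H)} (cover : ∀ x : X, ∃ e ∈ A, x ∈ e.source)
    (compatible : ∀ e ∈ A, ∀ e' ∈ A, e.symm ≫ₕ e' ∈ G) (h : A ⊆ σ.charts) :
    GStructure.generate G A cover compatible = σ :=
  Eq.symm <| eq_of_charts_subset (σ' := .generate G A cover compatible)
    fun e he e' he' => σ.compatible e' (h he') e he

end GStructure

variable {Γ : Subgroup (Equiv.Perm H)}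

theorem symm_trans_mem_localGroupoid_iff {e e' : OpenPartialHomeomorph X H} :
    e.symm ≫ₕ e' ∈ localGroupoid Γ ↔
      ∀ x ∈ e.source, x ∈ e'.source → ∃ g ∈ Γ, ∀ᶠ y in 𝓝 x, e' y = g (e y) := by
  constructor
  · intro h x hx hx'
    obtain ⟨g, hg, hgx⟩ := h (e x) (by simp [hx, hx'])
    refine ⟨g, hg, ?_⟩
    filter_upwards [(e.continuousAt hx).eventually hgx, e.open_source.mem_nhds hx] with y hy hys
    simpa [e.left_inv hys] using hy
  · intro h x hx
    rw [OpenPartialHomeomorph.trans_source] at hx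
    obtain ⟨g, hg, hgx⟩ := h (e.symm x) (e.map_target hx.1) hx.2
    refine ⟨g, hg, ?_⟩
    filter_upwards [(e.symm.continuousAt hx.1).eventually hgx, e.open_target.mem_nhds hx.1]
      with y hy hys
    simpa [e.right_inv hys] using hy

namespace GStructure

variable {σ : GStructure (localGroupoid Γ) X} {f : X ≃ₜ X}

theorem mem_aut_iff :
    f ∈ σ.aut ↔ ∀ e ∈ σ.charts, ∀ e' ∈ σ.charts, ∀ x ∈ e.source, f x ∈ e'.source →
      ∃ g ∈ Γ, ∀ᶠ y in 𝓝 x, e' (f y) = g (e y) := by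
  refine forall₄_congr fun e _ e' _ => ?_
  rw [symm_trans_mem_localGroupoid_iff]
  simp

end GStructure

/-- `D : Y → H` is a developing map over the local homeomorphism `p : Y → X`, with holonomy in `Γ`:
a local homeomorphism whose values at nearby points of two sheets of `p` differ by an element of
`Γ`. When `p` is a regular covering this is the usual equivariance under deck transformations. -/
structure IsDevelopingMap (Γ : Subgroup (Equiv.Perm H)) (p : Y → X) (D : Y → H) : Prop where
  isLocalHomeomorph : IsLocalHomeomorph D
  equivariant : ∀ y y', p y = p y' →
    ∃ g ∈ Γ, ∀ᶠ w in 𝓝 (y, y'), p w.1 = p w.2 → D w.2 = g (D w.1)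

variable {p : Y → X} {D : Y → H}

theorem IsDevelopingMap.exists_chart (hp : IsLocalHomeomorph p) (hD : IsDevelopingMap Γ p D)
    (y : Y) : ∃ e : OpenPartialHomeomorph X H, p y ∈ e.source ∧
      ∀ z, p z ∈ e.source → ∃ g ∈ Γ, ∀ᶠ w in 𝓝 z, e (p w) = g (D w) := by
  obtain ⟨s, hys, rfl⟩ := hp y
  obtain ⟨d, hyd, rfl⟩ := hD.isLocalHomeomorph y
  refine ⟨s.symm ≫ₕ d, by simp [hys, hyd], fun z hz => ?_⟩
  have hzs : s z ∈ s.target := by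
    rw [OpenPartialHomeomorph.trans_source] at hz
    exact hz.1
  obtain ⟨g, hg, hgz⟩ := hD.equivariant z (s.symm (s z)) (s.right_inv hzs).symm
  have hcont : ContinuousAt (fun w => (w, s.symm (s w))) z :=
    continuousAt_id.prodMk
      ((s.symm.continuousAt hzs).comp hp.continuous.continuousAt)
  refine ⟨g, hg, ?_⟩
  filter_upwards [hcont.eventually hgz,
    hp.continuous.continuousAt.eventually (s.open_target.mem_nhds hzs)] with w hw hws
  exact hw (s.right_inv hws).symm

/-- The geometric structure on `X` developed by `D`: its charts are those which, pulled back by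
`p`, agree locally with `D` up to elements of `Γ`. -/
def GStructure.ofDevelopingMap (hp : IsLocalHomeomorph p) (hs : p.Surjective)
    (hD : IsDevelopingMap Γ p D) : GStructure (localGroupoid Γ) X where
  charts := {e | ∀ y, p y ∈ e.source → ∃ g ∈ Γ, ∀ᶠ w in 𝓝 y, e (p w) = g (D w)}
  cover := hs.forall.2 fun y => (hD.exists_chart hp y).imp fun _ h => h.symm
  compatible := by
    intro e he e' he'
    refine symm_trans_mem_localGroupoid_iff.2 <| hs.forall.2 fun y hy hy' => ?_
    obtain ⟨g, hg, h⟩ := he y hy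
    obtain ⟨g', hg', h'⟩ := he' y hy'
    refine ⟨g' * g⁻¹, mul_mem hg' (inv_mem hg), ?_⟩
    rw [← hp.map_nhds_eq, eventually_map]
    filter_upwards [h, h'] with w hw hw'
    simp [hw, hw']
  maximal := by
    intro e he y hy
    obtain ⟨c, hyc, hc⟩ := hD.exists_chart hp y
    obtain ⟨g, hg, h⟩ := symm_trans_mem_localGroupoid_iff.1 (he c hc) (p y) hyc hy
    obtain ⟨k, hk, h'⟩ := hc y hyc
    refine ⟨g * k, mul_mem hg hk, ?_⟩
    filter_upwards [hp.continuous.continuousAt.eventually h, h'] with w hw hw'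
    simp [hw, hw']

theorem GStructure.mem_aut_ofDevelopingMap_iff {hp : IsLocalHomeomorph p} {hs : p.Surjective}
    {hD : IsDevelopingMap Γ p D} {f : X ≃ₜ X} {F : Y → Y} (hF : Continuous F)
    (hfF : ∀ y, f (p y) = p (F y)) :
    f ∈ (ofDevelopingMap hp hs hD).aut ↔
      ∀ y, ∃ g ∈ Γ, ∀ᶠ w in 𝓝 y, D (F w) = g (D w) := by
  rw [mem_aut_iff]
  constructor
  · intro h y
    obtain ⟨e, hye, he⟩ := hD.exists_chart hp y
    obtain ⟨e', hye', he'⟩ := hD.exists_chart hp (F y)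
    obtain ⟨g, hg, hgy⟩ := h e he e' he' (p y) hye (by rwa [hfF])
    obtain ⟨k, hk, hky⟩ := he y hye
    obtain ⟨l, hl, hly⟩ := he' (F y) hye'
    refine ⟨l⁻¹ * g * k, mul_mem (mul_mem (inv_mem hl) hg) hk, ?_⟩
    filter_upwards [hp.continuous.continuousAt.eventually hgy, hky,
      hF.continuousAt.eventually hly] with w hw hwk hwl
    rw [hfF, hwl, hwk] at hw
    simp [Equiv.Perm.mul_apply, ← hw]
  · refine fun h e he e' he' => hs.forall.2 fun y hye hye' => ?_
    rw [hfF] at hye'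
    obtain ⟨g, hg, hgy⟩ := h y
    obtain ⟨k, hk, hky⟩ := he y hye
    obtain ⟨l, hl, hly⟩ := he' (F y) hye'
    refine ⟨l * g * k⁻¹, mul_mem (mul_mem hl hg) (inv_mem hk), ?_⟩
    rw [← hp.map_nhds_eq, eventually_map]
    filter_upwards [hgy, hky, hF.continuousAt.eventually hly] with w hw hwk hwl
    simp [hfF, hwl, hwk, hw]

end GStructure

section Projective

variable {X Y : Type*} [TopologicalSpace Y] {p : Y → X} {D : Y → ℂ}

theorem IsDevelopingMap.coe_sphere (hD : IsDevelopingMap affineGroup p D) :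
    IsDevelopingMap moebiusGroup p fun y => (D y : Sphere) where
  isLocalHomeomorph := OnePoint.isOpenEmbedding_coe.isLocalHomeomorph.comp hD.isLocalHomeomorph
  equivariant y y' h := by
    obtain ⟨g, hg, hgy⟩ := hD.equivariant y y' h
    obtain ⟨m, hm, hmg⟩ := exists_moebius_of_affine hg
    exact ⟨m, hm, hgy.mono fun w hw hpw => by rw [hw hpw, hmg]⟩

theorem toProjective_ofDevelopingMap [TopologicalSpace X] (hp : IsLocalHomeomorph p)
    (hs : p.Surjective) (hD : IsDevelopingMap affineGroup p D) :
    toProjective (.ofDevelopingMap hp hs hD) = .ofDevelopingMap hp hs hD.coe_sphere := by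
  refine GStructure.generate_eq_of_subset_charts _ _ ?_
  rintro _ ⟨e, he, rfl⟩ y hy
  obtain ⟨g, hg, hgy⟩ := he y (by simpa [patch] using hy)
  obtain ⟨m, hm, hmg⟩ := exists_moebius_of_affine hg
  refine ⟨m, hm, hgy.mono fun w hw => ?_⟩
  rw [hmg, ← hw]
  rfl

end Projective

section Moebius

theorem exists_coeff_of_mem_moebiusGroup {m : Equiv.Perm Sphere} (hm : m ∈ moebiusGroup) :
    ∃ a b c d : ℂ, a * d - b * c ≠ 0 ∧
      ∀ z w : ℂ, m z = w → c * z + d ≠ 0 ∧ w = (a * z + b) / (c * z + d) := by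
  obtain ⟨M, rfl⟩ := hm
  refine ⟨M 0 0, M 0 1, M 1 0, M 1 1, ?_, fun z w h => ?_⟩
  · rw [← Matrix.det_fin_two]
    exact M.det_ne_zero
  · rw [MulAction.toPermHom_apply, MulAction.toPerm_apply, OnePoint.smul_some_eq_ite] at h
    split_ifs at h with h0
    · exact absurd h (OnePoint.infty_ne_coe _)
    · exact ⟨h0, (OnePoint.coe_injective h).symm⟩

theorem exists_mem_moebiusGroup_of_coeff {a b c d : ℂ} (h : a * d - b * c ≠ 0) :
    ∃ m ∈ moebiusGroup, ∀ z : ℂ, c * z + d ≠ 0 →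
      m (z : Sphere) = ((a * z + b) / (c * z + d) : ℂ) := by
  let M : GL (Fin 2) ℂ := Matrix.GeneralLinearGroup.mkOfDetNeZero !![a, b; c, d]
    (by simpa [Matrix.det_fin_two] using h)
  refine ⟨_, ⟨M, rfl⟩, fun z hz => ?_⟩
  rw [MulAction.toPermHom_apply, MulAction.toPerm_apply, OnePoint.smul_some_eq_ite]
  simp [M, Matrix.GeneralLinearGroup.mkOfDetNeZero, hz]

end Moebius

section RiemannSurface

variable {X : Type*} [TopologicalSpace X]

theorem trans_patch_mem_charts_toProjective {σ : AffineStructure X}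
    {e : OpenPartialHomeomorph X ℂ} (he : e ∈ σ.charts) :
    e ≫ₕ patch ∈ (toProjective σ).charts :=
  GStructure.subset_charts_generate _ _ ⟨e, he, rfl⟩

theorem exists_coeff_of_mem_moeb {σ : AffineStructure X} {f : X ≃ₜ X}
    (hf : f ∈ moeb (toProjective σ)) {e e' : OpenPartialHomeomorph X ℂ} (he : e ∈ σ.charts)
    (he' : e' ∈ σ.charts) {x : X} (hx : x ∈ e.source) (hx' : f x ∈ e'.source) :
    ∃ a b c d : ℂ, ∀ᶠ y in 𝓝 x, c * e y + d ≠ 0 ∧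
      e' (f y) = (a * e y + b) / (c * e y + d) := by
  obtain ⟨m, hm, h⟩ := GStructure.mem_aut_iff.1 hf _ (trans_patch_mem_charts_toProjective he) _
    (trans_patch_mem_charts_toProjective he') x (by simpa [patch] using hx)
    (by simpa [patch] using hx')
  obtain ⟨a, b, c, d, -, hm⟩ := exists_coeff_of_mem_moebiusGroup hm
  exact ⟨a, b, c, d, h.mono fun y hy => hm _ _ hy.symm⟩

theorem mdifferentiableAt_of_eventuallyEq_charts [ChartedSpace ℂ X] {f : X → X} {x : X}
    (hf : ContinuousAt f x) {e e' : OpenPartialHomeomorph X ℂ}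
    (he : e ∈ IsManifold.maximalAtlas 𝓘(ℂ) ω X) (he' : e' ∈ IsManifold.maximalAtlas 𝓘(ℂ) ω X)
    (hx : x ∈ e.source) (hx' : f x ∈ e'.source) {φ : ℂ → ℂ} (hφ : DifferentiableAt ℂ φ (e x))
    (h : ∀ᶠ y in 𝓝 x, e' (f y) = φ (e y)) :
    MDifferentiableAt 𝓘(ℂ) 𝓘(ℂ) f x := by
  have hde : MDifferentiableAt 𝓘(ℂ) 𝓘(ℂ) e x :=
    (contMDiffAt_of_mem_maximalAtlas he hx).mdifferentiableAt (by simp)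
  have hde' : MDifferentiableAt 𝓘(ℂ) 𝓘(ℂ) e'.symm (φ (e x)) := by
    rw [← h.self_of_nhds]
    exact (contMDiffAt_symm_of_mem_maximalAtlas he' (e'.map_source hx')).mdifferentiableAt
      (by simp)
  refine (hde'.comp x (hφ.mdifferentiableAt.comp x hde)).congr_of_eventuallyEq ?_
  filter_upwards [h, hf.eventually (e'.open_source.mem_nhds hx')] with y hy hy'
  rw [Function.comp_apply, Function.comp_apply, ← hy, e'.left_inv hy']

theorem moeb_le_holAut [ChartedSpace ℂ X] {σ : AffineStructure X}
    (hσ : σ ∈ affineStructures X) : moeb (toProjective σ) ≤ holAut X := by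
  have key : ∀ f ∈ moeb (toProjective σ), MDifferentiable 𝓘(ℂ) 𝓘(ℂ) f := by
    intro f hf x
    obtain ⟨e, he, hx⟩ := σ.cover x
    obtain ⟨e', he', hx'⟩ := σ.cover (f x)
    obtain ⟨a, b, c, d, h⟩ := exists_coeff_of_mem_moeb hf he he' hx hx'
    have hφ : DifferentiableAt ℂ (fun z => (a * z + b) / (c * z + d)) (e x) :=
      .div (by fun_prop) (by fun_prop) h.self_of_nhds.1
    exact mdifferentiableAt_of_eventuallyEq_charts f.continuous.continuousAt (hσ he) (hσ he')
      hx hx' hφ (h.mono fun y hy => hy.2)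
  exact fun f hf => ⟨key f hf, key _ (inv_mem hf)⟩

end RiemannSurface

section Holomorphic

theorem isLocalHomeomorph_of_deriv_ne_zero {D : ℂ → ℂ} (hD : Differentiable ℂ D)
    (hD' : ∀ z, deriv D z ≠ 0) : IsLocalHomeomorph D := by
  intro z
  have h := (hD.analyticAt z).hasStrictDerivAt.hasStrictFDerivAt_equiv (hD' z)
  exact ⟨h.toOpenPartialHomeomorph, h.mem_toOpenPartialHomeomorph_source, rfl⟩

theorem mem_contDiffGroupoid_iff {e : OpenPartialHomeomorph ℂ ℂ} :
    e ∈ contDiffGroupoid ω 𝓘(ℂ) ↔ ∀ z ∈ e.source, AnalyticAt ℂ e z ∧ deriv e z ≠ 0 := by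
  have hmem : e ∈ contDiffGroupoid ω 𝓘(ℂ) ↔
      ContDiffOn ℂ ω e e.source ∧ ContDiffOn ℂ ω e.symm e.target := by
    rw [contDiffGroupoid, mem_groupoid_of_pregroupoid]
    simp [contDiffPregroupoid]
  rw [hmem]
  constructor
  · rintro ⟨h, h'⟩ z hz
    have hz' := e.map_source hz
    have hd : DifferentiableAt ℂ e z :=
      (h.contDiffAt (e.open_source.mem_nhds hz)).differentiableAt (by simp)
    have hd' : DifferentiableAt ℂ e.symm (e z) :=
      (h'.contDiffAt (e.open_target.mem_nhds hz')).differentiableAt (by simp)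
    have hinv : deriv e.symm (e z) * deriv e z = 1 := by
      have hcomp := hd'.hasDerivAt.comp z hd.hasDerivAt
      have hid : id =ᶠ[𝓝 z] e.symm ∘ e := (e.eventually_left_inverse hz).mono fun _ => Eq.symm
      exact (hcomp.congr_of_eventuallyEq hid).unique (hasDerivAt_id z)
    exact ⟨(h.contDiffAt (e.open_source.mem_nhds hz)).analyticAt,
      right_ne_zero_of_mul_eq_one hinv⟩
  · refine fun h => ⟨fun z hz => (h z hz).1.contDiffAt.contDiffWithinAt, fun w hw => ?_⟩
    obtain ⟨ha, hd⟩ := h _ (e.map_target hw)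
    exact (e.contDiffAt_symm_deriv hd hw ha.differentiableAt.hasDerivAt
      ha.contDiffAt).contDiffWithinAt

end Holomorphic

section Torus

variable {τ : UpperHalfPlane}

theorem isCoveringMap_proj (τ : UpperHalfPlane) : IsCoveringMap (proj τ) :=
  (AddSubgroup.isAddQuotientCoveringMap_of_comm (lattice τ)
    ⟨inferInstanceAs (DiscreteTopology (lattice τ))⟩).isCoveringMap

theorem continuous_proj (τ : UpperHalfPlane) : Continuous (proj τ) :=
  (isLocalHomeomorph_proj τ).continuous

theorem proj_surjective (τ : UpperHalfPlane) : (proj τ).Surjective :=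
  QuotientAddGroup.mk_surjective

theorem proj_eq_proj_iff {z w : ℂ} : proj τ z = proj τ w ↔ w - z ∈ lattice τ := by
  rw [QuotientAddGroup.eq, sub_eq_neg_add]

theorem proj_add_of_mem_lattice {l : ℂ} (hl : l ∈ lattice τ) (z : ℂ) :
    proj τ (z + l) = proj τ z :=
  (proj_eq_proj_iff.2 (by simpa using hl)).symm

theorem eventually_eq_add_of_proj_eq {l : ℂ} (hl : l ∈ lattice τ) (z : ℂ) :
    ∀ᶠ w in 𝓝 (z, z + l), proj τ w.1 = proj τ w.2 → w.2 = w.1 + l := by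
  obtain ⟨U, hU, hzU, hinj⟩ := (isLocalHomeomorph_proj τ).isLocallyInjective (z + l)
  have h₁ : ∀ᶠ w : ℂ × ℂ in 𝓝 (z, z + l), w.1 + l ∈ U :=
    (continuous_fst.add continuous_const).continuousAt.eventually (hU.mem_nhds hzU)
  have h₂ : ∀ᶠ w : ℂ × ℂ in 𝓝 (z, z + l), w.2 ∈ U :=
    continuous_snd.continuousAt.eventually (hU.mem_nhds hzU)
  filter_upwards [h₁, h₂] with w hw₁ hw₂ hw
  exact hinj hw₂ hw₁ (by rw [proj_add_of_mem_lattice hl, hw])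

theorem exists_mem_euclideanAtlas (τ : UpperHalfPlane) (z : ℂ) :
    ∃ e ∈ euclideanAtlas τ, proj τ z ∈ e.source ∧ ∀ᶠ w in 𝓝 z, e (proj τ w) = w := by
  obtain ⟨s, hz, hs⟩ := isLocalHomeomorph_proj τ z
  refine ⟨s.symm, hs.symm, hs ▸ s.map_source hz, ?_⟩
  rw [hs]
  exact s.eventually_left_inverse hz

theorem euclideanAtlas_subset_maximalAtlas (τ : UpperHalfPlane) :
    euclideanAtlas τ ⊆ IsManifold.maximalAtlas 𝓘(ℂ) ω (Torus τ) :=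
  IsManifold.subset_maximalAtlas (I := 𝓘(ℂ)) (n := ω) (M := Torus τ)

theorem mem_maximalAtlas_iff_comp_proj {e : OpenPartialHomeomorph (Torus τ) ℂ} :
    e ∈ IsManifold.maximalAtlas 𝓘(ℂ) ω (Torus τ) ↔ ∀ z, proj τ z ∈ e.source →
      AnalyticAt ℂ (e ∘ proj τ) z ∧ deriv (e ∘ proj τ) z ≠ 0 := by
  have htransition : ∀ c ∈ euclideanAtlas τ, c.symm ≫ₕ e ∈ contDiffGroupoid ω 𝓘(ℂ) ↔
      ∀ z ∈ c.target, proj τ z ∈ e.source →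
        AnalyticAt ℂ (e ∘ proj τ) z ∧ deriv (e ∘ proj τ) z ≠ 0 := by
    intro c hc
    have hc : ⇑c.symm = proj τ := hc
    rw [mem_contDiffGroupoid_iff, OpenPartialHomeomorph.coe_trans, hc]
    simp [hc, and_imp]
  rw [IsManifold.mem_maximalAtlas_iff, mem_maximalAtlas_iff]
  constructor
  · intro h z hz
    obtain ⟨c, hc, hzc, hcz⟩ := exists_mem_euclideanAtlas τ z
    exact (htransition c hc).1 (h c hc).2 z (hcz.self_of_nhds ▸ c.map_source hzc) hz
  · intro h c hc
    have hce : c.symm ≫ₕ e ∈ contDiffGroupoid ω 𝓘(ℂ) := (htransition c hc).2 fun z _ => h z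
    refine ⟨?_, hce⟩
    simpa [OpenPartialHomeomorph.trans_symm_eq_symm_trans_symm] using
      (contDiffGroupoid ω 𝓘(ℂ)).symm hce

theorem mdifferentiable_proj (τ : UpperHalfPlane) : MDifferentiable 𝓘(ℂ) 𝓘(ℂ) (proj τ) := by
  intro z
  obtain ⟨e, he, hz, hez⟩ := exists_mem_euclideanAtlas τ z
  have h := (contMDiffAt_symm_of_mem_maximalAtlas (euclideanAtlas_subset_maximalAtlas τ he)
    (e.map_source hz)).mdifferentiableAt (by simp)
  rwa [hez.self_of_nhds, he] at h

theorem mdifferentiable_iff_of_lift {f : Torus τ → Torus τ} {F : ℂ → ℂ} (hF : Continuous F)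
    (hfF : ∀ z, f (proj τ z) = proj τ (F z)) :
    MDifferentiable 𝓘(ℂ) 𝓘(ℂ) f ↔ Differentiable ℂ F := by
  constructor
  · intro hf z
    obtain ⟨e, he, hz, hez⟩ := exists_mem_euclideanAtlas τ (F z)
    rw [← hfF] at hz
    have hde := (contMDiffAt_of_mem_maximalAtlas (euclideanAtlas_subset_maximalAtlas τ he)
      hz).mdifferentiableAt (by simp)
    refine mdifferentiableAt_iff_differentiableAt.1 <|
      (hde.comp z ((hf _).comp z (mdifferentiable_proj τ z))).congr_of_eventuallyEq ?_
    filter_upwards [hF.continuousAt.eventually hez] with w hw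
    rw [Function.comp_apply, Function.comp_apply, hfF, hw]
  · refine fun hd => (proj_surjective τ).forall.2 fun z => ?_
    obtain ⟨e, he, hz, hez⟩ := exists_mem_euclideanAtlas τ z
    have hde := (contMDiffAt_of_mem_maximalAtlas (euclideanAtlas_subset_maximalAtlas τ he)
      hz).mdifferentiableAt (by simp)
    refine (((mdifferentiable_proj τ _).comp _ (hd _).mdifferentiableAt).comp _
      hde).congr_of_eventuallyEq ?_
    rw [EventuallyEq, ← (isLocalHomeomorph_proj τ).map_nhds_eq, eventually_map]
    filter_upwards [hez] with w hw
    rw [Function.comp_apply, Function.comp_apply, hw, hfF]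

theorem exists_continuous_lift {f : Torus τ → Torus τ} (hf : Continuous f) :
    ∃ F : ℂ → ℂ, Continuous F ∧ ∀ z, f (proj τ z) = proj τ (F z) := by
  obtain ⟨z, hz⟩ := proj_surjective τ (f (proj τ 0))
  obtain ⟨F, ⟨-, hF⟩, -⟩ := (isCoveringMap_proj τ).existsUnique_continuousMap_lifts
    ⟨f ∘ proj τ, hf.comp (continuous_proj τ)⟩ 0 z hz
  exact ⟨F, F.continuous, fun z => (congrFun hF z).symm⟩

theorem eq_of_forall_mem_lattice {Y : Type*} [TopologicalSpace Y] [PreconnectedSpace Y]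
    {F : Y → ℂ} (hF : Continuous F) (h : ∀ y, F y ∈ lattice τ) (y y' : Y) : F y = F y' :=
  congrArg Subtype.val <| PreconnectedSpace.constant inferInstance
    (f := fun y => (⟨F y, h y⟩ : lattice τ)) (hF.subtype_mk h)

theorem eq_of_differentiable_of_periodic {F : ℂ → ℂ} (hF : Differentiable ℂ F)
    (hper : ∀ l ∈ lattice τ, ∀ z, F (z + l) = F z) (z w : ℂ) : F z = F w := by
  have hcompact : IsCompact (range F) :=
    IsZLattice.isCompact_range_of_periodic (periodPair τ).lattice F hF.continuous
      fun z l hl => hper l (by rwa [lattice_eq]) z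
  exact hF.apply_eq_apply_of_bounded hcompact.isBounded z w

theorem deriv_periodic_of_lift {f : Torus τ → Torus τ} {F : ℂ → ℂ} (hF : Continuous F)
    (hfF : ∀ z, f (proj τ z) = proj τ (F z)) {l : ℂ} (hl : l ∈ lattice τ) (z : ℂ) :
    deriv F (z + l) = deriv F z := by
  have hmem : ∀ w, F (w + l) - F w ∈ lattice τ := fun w => by
    rw [← proj_eq_proj_iff, ← hfF, ← hfF, proj_add_of_mem_lattice hl]
  have hshift : (fun w => F (w + l)) = fun w => F w + (F (z + l) - F z) := by
    ext w
    linear_combination eq_of_forall_mem_lattice (by fun_prop) hmem w z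
  rw [← deriv_comp_add_const, hshift, deriv_add_const]

theorem exists_affine_lift {f : Torus τ → Torus τ} (hf : MDifferentiable 𝓘(ℂ) 𝓘(ℂ) f) :
    ∃ a b : ℂ, ∀ z, f (proj τ z) = proj τ (a * z + b) := by
  obtain ⟨F, hF, hfF⟩ := exists_continuous_lift hf.continuous
  have hd : Differentiable ℂ F := (mdifferentiable_iff_of_lift hF hfF).1 hf
  have hconst : ∀ z, deriv F z = deriv F 0 := fun z =>
    eq_of_differentiable_of_periodic hd.contDiff.differentiable_deriv_two
      (fun _ => deriv_periodic_of_lift hF hfF) z 0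
  have haffine : ∀ z, F z - deriv F 0 * z = F 0 - deriv F 0 * 0 := fun z =>
    is_const_of_deriv_eq_zero (f := fun z => F z - deriv F 0 * z) (by fun_prop) (fun w => by
      rw [deriv_fun_sub hd.differentiableAt (by fun_prop), deriv_const_mul_field, deriv_id'',
        hconst w]
      simp) z 0
  refine ⟨deriv F 0, F 0, fun z => ?_⟩
  rw [hfF]
  congr 1
  linear_combination haffine z

end Torus

section PreSchwarzian

/-- The pre-Schwarzian derivative `u'' / u'`, the local invariant of `u` under postcomposition with
affine maps; it takes the junk value `0` where `u' = 0`. -/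
def preSchwarzian (u : ℂ → ℂ) : ℂ → ℂ := logDeriv (deriv u)

theorem preSchwarzian_comp_add_const (u : ℂ → ℂ) (l z : ℂ) :
    preSchwarzian (fun w => u (w + l)) z = preSchwarzian u (z + l) := by
  have hderiv : deriv (fun w => u (w + l)) = fun w => deriv u (w + l) :=
    funext fun w => deriv_comp_add_const u l w
  rw [preSchwarzian, preSchwarzian, hderiv, logDeriv_apply, logDeriv_apply, deriv_comp_add_const]

theorem preSchwarzian_id : preSchwarzian id = 0 := by
  ext z
  simp [preSchwarzian, logDeriv_apply]

theorem deriv_exp_const_mul (c z : ℂ) :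
    deriv (fun w => Complex.exp (c * w)) z = c * Complex.exp (c * z) := by
  simpa [mul_comm] using ((hasDerivAt_id z).const_mul c).cexp.deriv

theorem preSchwarzian_exp_const_mul {c : ℂ} (hc : c ≠ 0) :
    preSchwarzian (fun w => Complex.exp (c * w)) = fun _ => c := by
  ext z
  rw [preSchwarzian, funext (deriv_exp_const_mul c), logDeriv_const_mul _ _ hc, logDeriv_apply,
    deriv_exp_const_mul, mul_div_cancel_right₀ _ (Complex.exp_ne_zero _)]

variable {u v : ℂ → ℂ} {z : ℂ}

theorem preSchwarzian_eq_of_eventually_eq_affine {g : Equiv.Perm ℂ} (hg : g ∈ affineGroup)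
    (h : ∀ᶠ w in 𝓝 z, u w = g (v w)) : preSchwarzian u z = preSchwarzian v z := by
  obtain ⟨a, b, ha, hgab⟩ := hg
  have huv : u =ᶠ[𝓝 z] fun w => a * v w + b := h.mono fun w hw => hw.trans (hgab _)
  have hderiv : deriv u =ᶠ[𝓝 z] fun w => a * deriv v w := by
    refine huv.deriv.trans (.of_eq <| funext fun w => ?_)
    rw [deriv_add_const, deriv_const_mul_field]
  rw [preSchwarzian, (logDeriv_congr_nhds hderiv).self_of_nhds, logDeriv_const_mul _ _ ha,
    preSchwarzian]

theorem exists_eventually_eq_affine_of_preSchwarzian_eq (hu : AnalyticAt ℂ u z)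
    (hv : AnalyticAt ℂ v z) (hu' : deriv u z ≠ 0) (hv' : deriv v z ≠ 0)
    (h : preSchwarzian u =ᶠ[𝓝 z] preSchwarzian v) :
    ∃ g ∈ affineGroup, ∀ᶠ w in 𝓝 z, u w = g (v w) := by
  obtain ⟨r, hr, hball⟩ := Metric.eventually_nhds_iff_ball.1 <|
    (hu.eventually_analyticAt.and hv.eventually_analyticAt).and <|
    ((hu.deriv.continuousAt.eventually_ne hu').and (hv.deriv.continuousAt.eventually_ne hv')).and h
  have hpre : IsPreconnected (Metric.ball z r) := (convex_ball z r).isPreconnected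
  obtain ⟨a, ha, hderiv⟩ := (logDeriv_eqOn_iff
    (fun w hw => (hball w hw).1.1.deriv.differentiableAt.differentiableWithinAt)
    (fun w hw => (hball w hw).1.2.deriv.differentiableAt.differentiableWithinAt)
    Metric.isOpen_ball hpre (fun w hw => (hball w hw).2.1.2) (fun w hw => (hball w hw).2.1.1)).1
    (fun w hw => (hball w hw).2.2)
  obtain ⟨b, hb⟩ := Metric.isOpen_ball.exists_eq_add_of_deriv_eq (g := fun w => a * v w) hpre
    (fun w hw => (hball w hw).1.1.differentiableAt.differentiableWithinAt)
    (fun w hw => ((hball w hw).1.2.differentiableAt.const_mul a).differentiableWithinAt)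
    (fun w hw => (hderiv hw).trans (deriv_const_mul_field a).symm)
  exact ⟨(Equiv.mulLeft₀ a ha).trans (Equiv.addRight b), ⟨a, b, ha, fun _ => rfl⟩,
    Filter.eventually_of_mem (Metric.ball_mem_nhds z hr) hb⟩

end PreSchwarzian

section Classification

variable {τ : UpperHalfPlane} {σ : AffineStructure (Torus τ)} {D : ℂ → ℂ}

theorem isDevelopingMap_of_lattice (hD : Differentiable ℂ D) (hD' : ∀ z, deriv D z ≠ 0)
    (hper : ∀ l ∈ lattice τ, ∃ g ∈ affineGroup, ∀ z, D (z + l) = g (D z)) :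
    IsDevelopingMap affineGroup (proj τ) D where
  isLocalHomeomorph := isLocalHomeomorph_of_deriv_ne_zero hD hD'
  equivariant z z' h := by
    obtain ⟨l, hl, rfl⟩ : ∃ l ∈ lattice τ, z + l = z' := ⟨z' - z, proj_eq_proj_iff.1 h, by simp⟩
    obtain ⟨g, hg, hgD⟩ := hper l hl
    exact ⟨g, hg, (eventually_eq_add_of_proj_eq hl z).mono fun w hw hpw => by rw [hw hpw, hgD]⟩

/-- The affine structure on `X_τ` with developing map `D : ℂ → ℂ`. -/
abbrev affineStructureOfDevelopingMap (hD : IsDevelopingMap affineGroup (proj τ) D) :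
    AffineStructure (Torus τ) :=
  .ofDevelopingMap (isLocalHomeomorph_proj τ) (proj_surjective τ) hD

theorem affineStructureOfDevelopingMap_mem_affineStructures
    (hD : IsDevelopingMap affineGroup (proj τ) D) (hd : Differentiable ℂ D)
    (hd' : ∀ z, deriv D z ≠ 0) :
    affineStructureOfDevelopingMap hD ∈ affineStructures (Torus τ) := by
  refine fun e he => mem_maximalAtlas_iff_comp_proj.2 fun z hz => ?_
  obtain ⟨g, ⟨a, b, ha, hg⟩, h⟩ := he z hz
  have heq : e ∘ proj τ =ᶠ[𝓝 z] fun w => a * D w + b := h.mono fun w hw => hw.trans (hg _)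
  rw [heq.deriv_eq, deriv_add_const, deriv_const_mul_field]
  exact ⟨((analyticAt_const.mul (hd.analyticAt z)).add analyticAt_const).congr heq.symm,
    mul_ne_zero ha (hd' z)⟩

/-- The pre-Schwarzian derivative of the charts of `σ`, read in the coordinate `z` of the universal
cover `ℂ`. It does not depend on the chart, and it encodes the difference between the flat
connections of `σ` and of the Euclidean uniformization. -/
def liftedPreSchwarzian (σ : AffineStructure (Torus τ)) (z : ℂ) : ℂ :=
  preSchwarzian ((σ.cover (proj τ z)).choose ∘ proj τ) z

theorem liftedPreSchwarzian_eq {e : OpenPartialHomeomorph (Torus τ) ℂ} (he : e ∈ σ.charts) {z : ℂ}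
    (hz : proj τ z ∈ e.source) : liftedPreSchwarzian σ z = preSchwarzian (e ∘ proj τ) z := by
  obtain ⟨hc, hzc⟩ := (σ.cover (proj τ z)).choose_spec
  obtain ⟨g, hg, h⟩ := symm_trans_mem_localGroupoid_iff.1 (σ.compatible e he _ hc) _ hz hzc
  exact preSchwarzian_eq_of_eventually_eq_affine hg ((continuous_proj τ).continuousAt.eventually h)

theorem liftedPreSchwarzian_eventuallyEq {e : OpenPartialHomeomorph (Torus τ) ℂ}
    (he : e ∈ σ.charts) {z : ℂ} (hz : proj τ z ∈ e.source) :
    liftedPreSchwarzian σ =ᶠ[𝓝 z] preSchwarzian (e ∘ proj τ) :=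
  ((continuous_proj τ).continuousAt.eventually (e.open_source.mem_nhds hz)).mono
    fun _ => liftedPreSchwarzian_eq he

theorem liftedPreSchwarzian_ofDevelopingMap (hD : IsDevelopingMap affineGroup (proj τ) D) :
    liftedPreSchwarzian (affineStructureOfDevelopingMap hD) = preSchwarzian D := by
  ext z
  obtain ⟨e, he, hz⟩ := (affineStructureOfDevelopingMap hD).cover (proj τ z)
  obtain ⟨g, hg, h⟩ := he z hz
  exact (liftedPreSchwarzian_eq he hz).trans (preSchwarzian_eq_of_eventually_eq_affine hg h)

theorem liftedPreSchwarzian_add (σ : AffineStructure (Torus τ)) {l : ℂ} (hl : l ∈ lattice τ)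
    (z : ℂ) : liftedPreSchwarzian σ (z + l) = liftedPreSchwarzian σ z := by
  obtain ⟨e, he, hz⟩ := σ.cover (proj τ z)
  rw [liftedPreSchwarzian_eq he hz,
    liftedPreSchwarzian_eq he ((proj_add_of_mem_lattice hl z).symm ▸ hz),
    ← preSchwarzian_comp_add_const]
  congr 1
  ext w
  exact congrArg e (proj_add_of_mem_lattice hl w)

theorem differentiable_liftedPreSchwarzian (hσ : σ ∈ affineStructures (Torus τ)) :
    Differentiable ℂ (liftedPreSchwarzian σ) := by
  intro z
  obtain ⟨e, he, hz⟩ := σ.cover (proj τ z)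
  obtain ⟨hA, hA'⟩ := mem_maximalAtlas_iff_comp_proj.1 (hσ he) z hz
  exact (hA.deriv.deriv.div hA.deriv hA').differentiableAt.congr_of_eventuallyEq
    (liftedPreSchwarzian_eventuallyEq he hz)

theorem exists_liftedPreSchwarzian_eq_const (hσ : σ ∈ affineStructures (Torus τ)) :
    ∃ c, liftedPreSchwarzian σ = fun _ => c :=
  ⟨_, funext fun z => eq_of_differentiable_of_periodic (differentiable_liftedPreSchwarzian hσ)
    (fun _ => liftedPreSchwarzian_add σ) z 0⟩

theorem eq_affineStructureOfDevelopingMap (hσ : σ ∈ affineStructures (Torus τ))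
    (hD : IsDevelopingMap affineGroup (proj τ) D) (hd : Differentiable ℂ D)
    (hd' : ∀ z, deriv D z ≠ 0) (h : liftedPreSchwarzian σ = preSchwarzian D) :
    σ = affineStructureOfDevelopingMap hD := by
  refine GStructure.eq_of_charts_subset fun e he z hz => ?_
  obtain ⟨hA, hA'⟩ := mem_maximalAtlas_iff_comp_proj.1 (hσ he) z hz
  exact exists_eventually_eq_affine_of_preSchwarzian_eq hA (hd.analyticAt z) hA' (hd' z)
    (h ▸ (liftedPreSchwarzian_eventuallyEq he hz).symm)

theorem isDevelopingMap_id (τ : UpperHalfPlane) : IsDevelopingMap affineGroup (proj τ) id :=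
  isDevelopingMap_of_lattice differentiable_id (by simp) fun l _ =>
    ⟨Equiv.addRight l, ⟨1, l, one_ne_zero, by simp⟩, fun _ => rfl⟩

theorem euclideanUniformization_eq (τ : UpperHalfPlane) :
    euclideanUniformization τ = affineStructureOfDevelopingMap (isDevelopingMap_id τ) := by
  refine GStructure.eq_of_charts_subset fun e he z hz => ?_
  obtain ⟨c, hc, hzc, hcz⟩ := exists_mem_euclideanAtlas τ z
  obtain ⟨g, hg, h⟩ := symm_trans_mem_localGroupoid_iff.1 (he c hc) _ hzc hz
  refine ⟨g, hg, ?_⟩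
  filter_upwards [hcz, (continuous_proj τ).continuousAt.eventually h] with w hw hw'
  rw [hw', hw, id]

theorem euclideanUniformization_mem_affineStructures (τ : UpperHalfPlane) :
    euclideanUniformization τ ∈ affineStructures (Torus τ) := by
  rw [euclideanUniformization_eq]
  exact affineStructureOfDevelopingMap_mem_affineStructures _ differentiable_id (by simp)

theorem deriv_exp_units_mul_ne_zero (c : ℂˣ) (z : ℂ) :
    deriv (fun w => Complex.exp (c * w)) z ≠ 0 := by
  rw [deriv_exp_const_mul]
  exact mul_ne_zero c.ne_zero (Complex.exp_ne_zero _)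

theorem isDevelopingMap_exp (τ : UpperHalfPlane) (c : ℂˣ) :
    IsDevelopingMap affineGroup (proj τ) fun z => Complex.exp (c * z) :=
  isDevelopingMap_of_lattice (by fun_prop) (deriv_exp_units_mul_ne_zero c) fun l _ =>
    ⟨Equiv.mulRight₀ (Complex.exp (c * l)) (Complex.exp_ne_zero _),
      ⟨Complex.exp (c * l), 0, Complex.exp_ne_zero _, fun z => by simp [mul_comm]⟩,
      fun z => by simp [mul_add, Complex.exp_add]⟩

/-- The affine structure on `X_τ` with developing map `z ↦ exp (c z)`, i.e. the quotient of `ℂˣ` by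
a group of homotheties when `2πi / c` is a period. -/
def exponentialStructure (τ : UpperHalfPlane) (c : ℂˣ) : AffineStructure (Torus τ) :=
  affineStructureOfDevelopingMap (isDevelopingMap_exp τ c)

theorem exponentialStructure_mem_affineStructures (τ : UpperHalfPlane) (c : ℂˣ) :
    exponentialStructure τ c ∈ affineStructures (Torus τ) :=
  affineStructureOfDevelopingMap_mem_affineStructures (isDevelopingMap_exp τ c) (by fun_prop)
    (deriv_exp_units_mul_ne_zero c)

theorem exponentialStructure_ne_euclideanUniformization (τ : UpperHalfPlane) (c : ℂˣ) :
    exponentialStructure τ c ≠ euclideanUniformization τ := by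
  intro h
  have hc := congrArg liftedPreSchwarzian h
  rw [exponentialStructure, euclideanUniformization_eq, liftedPreSchwarzian_ofDevelopingMap,
    liftedPreSchwarzian_ofDevelopingMap, preSchwarzian_id,
    preSchwarzian_exp_const_mul c.ne_zero] at hc
  exact c.ne_zero (congrFun hc 0)

theorem eq_euclideanUniformization_or_eq_exponentialStructure
    (hσ : σ ∈ affineStructures (Torus τ)) :
    σ = euclideanUniformization τ ∨ ∃ c, σ = exponentialStructure τ c := by
  obtain ⟨c, hc⟩ := exists_liftedPreSchwarzian_eq_const hσ
  obtain rfl | hc0 := eq_or_ne c 0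
  · refine .inl ?_
    rw [euclideanUniformization_eq]
    exact eq_affineStructureOfDevelopingMap hσ _ differentiable_id (by simp)
      (hc.trans preSchwarzian_id.symm)
  · refine .inr ⟨.mk0 c hc0, ?_⟩
    exact eq_affineStructureOfDevelopingMap hσ (isDevelopingMap_exp τ _) (by fun_prop)
      (deriv_exp_units_mul_ne_zero _) <| hc.trans (preSchwarzian_exp_const_mul hc0).symm

end Classification

section Units

open scoped Pointwise

variable {τ : UpperHalfPlane}

theorem mem_lattice_iff {z : ℂ} : z ∈ lattice τ ↔ ∃ m n : ℤ, (m : ℂ) + n * τ = z := by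
  simp [lattice, AddSubgroup.mem_closure_pair]

theorem one_mem_lattice (τ : UpperHalfPlane) : 1 ∈ lattice τ :=
  mem_lattice_iff.2 ⟨1, 0, by simp⟩

theorem coe_mem_lattice (τ : UpperHalfPlane) : (τ : ℂ) ∈ lattice τ :=
  mem_lattice_iff.2 ⟨0, 1, by simp⟩

theorem intCast_add_intCast_mul_coe_inj {m n m' n' : ℤ} :
    (m : ℂ) + n * τ = m' + n' * τ ↔ m = m' ∧ n = n' := by
  refine ⟨fun h => ?_, by rintro ⟨rfl, rfl⟩; rfl⟩
  have hn : n = n' := by simpa [τ.im_ne_zero] using congrArg Complex.im h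
  subst hn
  exact ⟨by simpa using h, rfl⟩

theorem one_half_notMem_lattice (τ : UpperHalfPlane) : 2⁻¹ ∉ lattice τ := by
  intro h
  obtain ⟨m, n, hmn⟩ := mem_lattice_iff.1 h
  have htwice : ((2 * m : ℤ) : ℂ) + (2 * n : ℤ) * τ = (1 : ℤ) + (0 : ℤ) * τ := by
    push_cast
    linear_combination 2 * hmn
  have := (intCast_add_intCast_mul_coe_inj.1 htwice).1
  omega

/-- The group of units of `Λ_τ`: the complex numbers `u` with `u Λ_τ = Λ_τ`. -/
abbrev latticeUnits (τ : UpperHalfPlane) : Subgroup ℂˣ := MulAction.stabilizer ℂˣ (lattice τ)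

theorem mem_latticeUnits_iff {u : ℂˣ} :
    u ∈ latticeUnits τ ↔ ∀ z : ℂ, ↑u * z ∈ lattice τ ↔ z ∈ lattice τ := by
  rw [MulAction.mem_stabilizer_iff, ← eq_inv_smul_iff, SetLike.ext_iff]
  refine forall_congr' fun z => ?_
  rw [Units.smul_def, Units.val_inv_eq_inv_val,
    AddSubgroup.mem_inv_pointwise_smul_iff₀ u.ne_zero, smul_eq_mul]
  exact iff_comm

theorem mul_mem_lattice_iff {u : ℂˣ} (hu : u ∈ latticeUnits τ) {z : ℂ} :
    ↑u * z ∈ lattice τ ↔ z ∈ lattice τ :=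
  mem_latticeUnits_iff.1 hu z

theorem exists_latticeUnit_of_lift {f : Torus τ → Torus τ} (hf : f.Injective) {a b : ℂ}
    (h : ∀ z, f (proj τ z) = proj τ (a * z + b)) : ∃ u ∈ latticeUnits τ, ↑u = a := by
  have hmem : ∀ z, a * z ∈ lattice τ ↔ z ∈ lattice τ := fun z => by
    have hinj : f (proj τ 0) = f (proj τ z) ↔ proj τ 0 = proj τ z := hf.eq_iff
    rwa [h, h, proj_eq_proj_iff, proj_eq_proj_iff, mul_zero, zero_add, add_sub_cancel_right,
      sub_zero] at hinj
  have ha : a ≠ 0 := by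
    rintro rfl
    exact one_half_notMem_lattice τ ((hmem _).1 (by simp [zero_mem]))
  exact ⟨.mk0 a ha, mem_latticeUnits_iff.2 hmem, rfl⟩

/-- Multiplication by a unit `u` of `Λ_τ`, as an endomorphism of `X_τ`. -/
def mulUnit (u : ℂˣ) (hu : u ∈ latticeUnits τ) : Torus τ → Torus τ :=
  QuotientAddGroup.map (lattice τ) (lattice τ) (AddMonoidHom.mulLeft (u : ℂ))
    fun _ => (mul_mem_lattice_iff hu).2

theorem mdifferentiable_mulUnit {u : ℂˣ} (hu : u ∈ latticeUnits τ) :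
    MDifferentiable 𝓘(ℂ) 𝓘(ℂ) (mulUnit u hu) :=
  (mdifferentiable_iff_of_lift (F := fun z => ↑u * z) (by fun_prop) fun _ => rfl).2 (by fun_prop)

theorem leftInverse_mulUnit {u v : ℂˣ} (hu : u ∈ latticeUnits τ) (hv : v ∈ latticeUnits τ)
    (huv : u * v = 1) : (mulUnit u hu).LeftInverse (mulUnit v hv) :=
  (proj_surjective τ).forall.2 fun z => congrArg (proj τ) (by
    change ↑u * (↑v * z) = z
    rw [← mul_assoc, ← Units.val_mul, huv, Units.val_one, one_mul])

theorem exists_mem_holAut_of_mem_latticeUnits {u : ℂˣ} (hu : u ∈ latticeUnits τ) :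
    ∃ f ∈ holAut (Torus τ), ∀ z, f (proj τ z) = proj τ (u * z) :=
  have hu' : u⁻¹ ∈ latticeUnits τ := inv_mem hu
  ⟨{  toFun := mulUnit u hu
      invFun := mulUnit u⁻¹ hu'
      left_inv := leftInverse_mulUnit hu' hu (inv_mul_cancel u)
      right_inv := leftInverse_mulUnit hu hu' (mul_inv_cancel u)
      continuous_toFun := (mdifferentiable_mulUnit hu).continuous
      continuous_invFun := (mdifferentiable_mulUnit hu').continuous },
    ⟨mdifferentiable_mulUnit hu, mdifferentiable_mulUnit hu'⟩, fun _ => rfl⟩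

theorem units_val_eq_neg_one_iff {u : ℂˣ} : (u : ℂ) = -1 ↔ u = -1 := by
  rw [Units.ext_iff, Units.val_neg, Units.val_one]

theorem exists_latticeUnit_iff_exists_mem_holAut :
    (∃ u ∈ latticeUnits τ, u ≠ 1 ∧ u ≠ -1) ↔
      ∃ f ∈ holAut (Torus τ), ∃ a : ℂ, a ≠ 1 ∧ a ≠ -1 ∧ ∀ z, f (proj τ z) = proj τ (a * z) := by
  constructor
  · rintro ⟨u, hu, hu1, hu2⟩
    obtain ⟨f, hf, hfu⟩ := exists_mem_holAut_of_mem_latticeUnits hu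
    exact ⟨f, hf, u, Units.val_eq_one.not.2 hu1, units_val_eq_neg_one_iff.not.2 hu2, hfu⟩
  · rintro ⟨f, -, a, ha1, ha2, hfa⟩
    obtain ⟨u, hu, rfl⟩ := exists_latticeUnit_of_lift (b := 0) f.injective (by simpa using hfa)
    exact ⟨u, hu, Units.val_eq_one.not.1 ha1, units_val_eq_neg_one_iff.not.1 ha2⟩

end Units

section EllipticPoints

open UpperHalfPlane
open scoped MatrixGroups

variable {τ : ℍ} {g : SL(2, ℤ)}

/-- `τ` is an elliptic point of the modular group if it is fixed by an element of `SL₂(ℤ)` which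
acts nontrivially on the upper half-plane. -/
def IsEllipticPoint (τ : ℍ) : Prop := ∃ g ∈ MulAction.stabilizer SL(2, ℤ) τ, g ≠ 1 ∧ g ≠ -1

theorem IsEllipticPoint.smul (hτ : IsEllipticPoint τ) (γ : SL(2, ℤ)) :
    IsEllipticPoint (γ • τ) := by
  obtain ⟨g, hg, hg1, hg2⟩ := hτ
  refine ⟨γ * g * γ⁻¹, ?_, by simpa using hg1, fun h => hg2 ?_⟩
  · rw [MulAction.mem_stabilizer_iff] at hg ⊢
    rw [mul_smul, inv_smul_smul, mul_smul, hg]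
  · rw [mul_inv_eq_iff_eq_mul, neg_one_mul] at h
    simpa using congrArg (γ⁻¹ * ·) h

theorem isEllipticPoint_smul_iff (γ : SL(2, ℤ)) : IsEllipticPoint (γ • τ) ↔ IsEllipticPoint τ :=
  ⟨fun h => by simpa only [inv_smul_smul] using h.smul γ⁻¹, fun h => h.smul γ⟩

theorem isEllipticPoint_I : IsEllipticPoint I :=
  ⟨ModularGroup.S, ModularGroup.stabilizer_I.2 (by simp), by decide, by decide⟩

theorem isEllipticPoint_ρ : IsEllipticPoint ρ :=
  ⟨ModularGroup.S * ModularGroup.T, ModularGroup.stabilizer_ρ.2 (by simp), by decide, by decide⟩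

open Modular in
theorem IsEllipticPoint.eq_of_mem_fd (hτ : IsEllipticPoint τ) (hfd : τ ∈ 𝒟) :
    τ = I ∨ τ = ρ ∨ τ = ModularGroup.T • ρ := by
  obtain ⟨g, hg, hg1, hg2⟩ := hτ
  by_contra! hne
  rw [modular_T_smul] at hne
  exact (ModularGroup.stabilizer_of_ne hfd hg hne.1 hne.2.1 hne.2.2).elim hg1 hg2

theorem isEllipticPoint_iff_exists_smul_eq :
    IsEllipticPoint τ ↔ ∃ γ : SL(2, ℤ), γ • τ = ρ ∨ γ • τ = I := by
  constructor
  · intro hτ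
    obtain ⟨γ, hγ⟩ := ModularGroup.exists_smul_mem_fd τ
    obtain h | h | h := (hτ.smul γ).eq_of_mem_fd hγ
    · exact ⟨γ, .inr h⟩
    · exact ⟨γ, .inl h⟩
    · exact ⟨ModularGroup.T⁻¹ * γ, .inl (by rw [mul_smul, h, inv_smul_smul])⟩
  · rintro ⟨γ, h | h⟩ <;> rw [← isEllipticPoint_smul_iff γ, h]
    exacts [isEllipticPoint_ρ, isEllipticPoint_I]

theorem coe_I_eq_exp : (I : ℂ) = Complex.exp (Complex.I * Real.pi / 2) := by
  rw [mul_comm, mul_div_right_comm, Complex.exp_pi_div_two_mul_I, coe_I]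

theorem coe_ρ_eq_exp : (ρ : ℂ) = Complex.exp (2 * Real.pi * Complex.I / 3) := by
  have harg : (2 * Real.pi * Complex.I / 3 : ℂ) =
      ((Real.pi - Real.pi / 3 : ℝ) : ℂ) * Complex.I := by
    push_cast
    ring
  rw [harg, Complex.exp_mul_I, ← Complex.ofReal_cos, ← Complex.ofReal_sin, Real.cos_pi_sub,
    Real.sin_pi_sub, Real.cos_pi_div_three, Real.sin_pi_div_three]
  norm_num [ρ, Complex.ext_iff]

theorem smul_eq_self_iff_denom_mul :
    g • τ = τ ↔ denom g τ * τ = g 0 0 * τ + g 0 1 := by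
  have hdenom : (g 1 0 : ℂ) * τ + g 1 1 ≠ 0 := by
    simpa [ModularGroup.denom_apply] using denom_ne_zero (g : GL (Fin 2) ℝ) τ
  rw [UpperHalfPlane.ext_iff, specialLinearGroup_apply, ModularGroup.denom_apply]
  simp only [algebraMap_int_eq, eq_intCast, Complex.ofReal_intCast]
  rw [div_eq_iff hdenom, eq_comm, mul_comm]

theorem injOn_denom_stabilizer (τ : ℍ) :
    InjOn (fun g : SL(2, ℤ) => denom g τ) (MulAction.stabilizer SL(2, ℤ) τ) := by
  intro g hg g' hg' h
  have hnum : (g 0 1 : ℂ) + g 0 0 * τ = g' 0 1 + g' 0 0 * τ := by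
    have hnum := congrArg (· * (τ : ℂ)) h
    simp only [smul_eq_self_iff_denom_mul.1 hg, smul_eq_self_iff_denom_mul.1 hg'] at hnum
    linear_combination hnum
  have hdenom : (g 1 1 : ℂ) + g 1 0 * τ = g' 1 1 + g' 1 0 * τ := by
    simp only [ModularGroup.denom_apply] at h
    linear_combination h
  obtain ⟨h01, h00⟩ := intCast_add_intCast_mul_coe_inj.1 hnum
  obtain ⟨h11, h10⟩ := intCast_add_intCast_mul_coe_inj.1 hdenom
  ext i j
  fin_cases i <;> fin_cases j <;> assumption

theorem denom_inv_mul_denom (hg : g • τ = τ) :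
    denom (g⁻¹ : SL(2, ℤ)) τ * denom g τ = 1 := by
  have hdet : (g 0 0 : ℂ) * g 1 1 - g 0 1 * g 1 0 = 1 := by
    exact_mod_cast (Matrix.det_fin_two _).symm.trans g.det_coe
  rw [smul_eq_self_iff_denom_mul, ModularGroup.denom_apply] at hg
  rw [ModularGroup.denom_apply, ModularGroup.denom_apply, Matrix.SpecialLinearGroup.SL2_inv_expl]
  simp only [Matrix.cons_val]
  push_cast
  linear_combination -(g 1 0 : ℂ) * hg + hdet

theorem denom_mul_mem_lattice (hg : g • τ = τ) {z : ℂ} (hz : z ∈ lattice τ) :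
    denom g τ * z ∈ lattice τ := by
  obtain ⟨m, n, rfl⟩ := mem_lattice_iff.1 hz
  rw [smul_eq_self_iff_denom_mul] at hg
  refine mem_lattice_iff.2 ⟨m * g 1 1 + n * g 0 1, m * g 1 0 + n * g 0 0, ?_⟩
  rw [mul_add, mul_left_comm, hg, ModularGroup.denom_apply]
  push_cast
  ring

theorem exists_normSq_eq_det {u : ℂ} (h1 : u ∈ lattice τ) (hτ : u * τ ∈ lattice τ) :
    ∃ a b c d : ℤ, u * τ = a * τ + b ∧ u = c * τ + d ∧ Complex.normSq u = (a * d - b * c : ℤ) := by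
  obtain ⟨d, c, rfl⟩ := mem_lattice_iff.1 h1
  obtain ⟨b, a, hab⟩ := mem_lattice_iff.1 hτ
  refine ⟨a, b, c, d, by rw [← hab, add_comm], add_comm _ _, ?_⟩
  have hre : b + a * τ.re = (d + c * τ.re) * τ.re - c * τ.im * τ.im := by
    simpa using congrArg Complex.re hab
  have him : a * τ.im = (d + c * τ.re) * τ.im + c * τ.im * τ.re := by
    simpa using congrArg Complex.im hab
  refine mul_right_cancel₀ τ.im_ne_zero ?_
  simp only [Complex.normSq_apply, Complex.add_re, Complex.add_im, Complex.mul_re, Complex.mul_im,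
    Complex.intCast_re, Complex.intCast_im, coe_re, coe_im]
  push_cast
  linear_combination c * τ.im * hre - (d + c * τ.re) * him

theorem mem_latticeUnits_iff_exists_denom {u : ℂˣ} :
    u ∈ latticeUnits τ ↔ ∃ g ∈ MulAction.stabilizer SL(2, ℤ) τ, denom g τ = u := by
  constructor
  · intro hu
    obtain ⟨a, b, c, d, hτ, h1, hdet⟩ := exists_normSq_eq_det (u := u)
      (by simpa using (mul_mem_lattice_iff hu).2 (one_mem_lattice τ))
      ((mul_mem_lattice_iff hu).2 (coe_mem_lattice τ))
    have hu' := inv_mem hu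
    obtain ⟨a', b', c', d', -, -, hdet'⟩ := exists_normSq_eq_det (u := (u⁻¹ : ℂˣ))
      (by simpa using (mul_mem_lattice_iff hu').2 (one_mem_lattice τ))
      ((mul_mem_lattice_iff hu').2 (coe_mem_lattice τ))
    have hmul : (a * d - b * c) * (a' * d' - b' * c') = 1 := by
      have : Complex.normSq u * Complex.normSq (u⁻¹ : ℂˣ) = 1 := by
        rw [← Complex.normSq_mul, Units.mul_inv, Complex.normSq_one]
      rw [hdet, hdet'] at this
      exact_mod_cast this
    have hnonneg : 0 ≤ a * d - b * c := by
      exact_mod_cast hdet ▸ Complex.normSq_nonneg (u : ℂ)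
    let g : SL(2, ℤ) := ⟨!![a, b; c, d], by
      rw [Matrix.det_fin_two_of, Int.eq_one_of_mul_eq_one_right hnonneg hmul]⟩
    have hg : denom g τ = u := by rw [ModularGroup.denom_apply, h1]; rfl
    exact ⟨g, smul_eq_self_iff_denom_mul.2 (by rw [hg, hτ]; rfl), hg⟩
  · rintro ⟨g, hg, hgu⟩
    refine mem_latticeUnits_iff.2 fun z => ⟨fun hz => ?_, fun hz => ?_⟩
    · have hinv := denom_mul_mem_lattice (inv_mem hg) hz
      rwa [← hgu, ← mul_assoc, denom_inv_mul_denom hg, one_mul] at hinv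
    · rw [← hgu]
      exact denom_mul_mem_lattice hg hz

theorem isEllipticPoint_iff_exists_latticeUnit :
    IsEllipticPoint τ ↔ ∃ u ∈ latticeUnits τ, u ≠ 1 ∧ u ≠ -1 := by
  have hstab : -1 ∈ MulAction.stabilizer SL(2, ℤ) τ :=
    (ModularGroup.SL_neg_smul 1 τ).trans (one_smul _ τ)
  have hdenom : denom (-1 : SL(2, ℤ)) τ = -1 := by
    rw [ModularGroup.denom_apply]
    simp
  have hone : ∀ g ∈ MulAction.stabilizer SL(2, ℤ) τ, denom g τ = 1 ↔ g = 1 := fun g hg => by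
    simpa using (injOn_denom_stabilizer τ).eq_iff hg (one_mem _)
  have hneg : ∀ g ∈ MulAction.stabilizer SL(2, ℤ) τ, denom g τ = -1 ↔ g = -1 := fun g hg => by
    rw [← hdenom]
    exact (injOn_denom_stabilizer τ).eq_iff hg hstab
  constructor
  · rintro ⟨g, hg, hg1, hg2⟩
    refine ⟨.mk0 (denom g τ) (denom_ne_zero _ τ),
      mem_latticeUnits_iff_exists_denom.2 ⟨g, hg, rfl⟩, ?_, ?_⟩
    · rwa [ne_eq, Units.ext_iff, Units.val_mk0, Units.val_one, hone g hg]
    · rwa [ne_eq, Units.ext_iff, Units.val_mk0, Units.val_neg, Units.val_one, hneg g hg]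
  · rintro ⟨u, hu, hu1, hu2⟩
    obtain ⟨g, hg, hgu⟩ := mem_latticeUnits_iff_exists_denom.1 hu
    refine ⟨g, hg, ?_, ?_⟩
    · rw [ne_eq, ← hone g hg, hgu]
      exact Units.val_eq_one.not.2 hu1
    · rw [ne_eq, ← hneg g hg, hgu]
      exact units_val_eq_neg_one_iff.not.2 hu2

end EllipticPoints

section Exponentials

theorem linearIndependent_exp_mul :
    LinearIndependent ℂ fun μ w : ℂ => Complex.exp (μ * w) := by
  let χ (μ : ℂ) : Multiplicative ℂ →* ℂ :=
    { toFun := fun w => Complex.exp (μ * w.toAdd)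
      map_one' := by simp
      map_mul' := fun x y => by simp [mul_add, Complex.exp_add] }
  have hχ : χ.Injective := fun μ ν h => by
    have hfun : (fun w => Complex.exp (μ * w)) = fun w => Complex.exp (ν * w) :=
      funext fun w => DFunLike.congr_fun h (Multiplicative.ofAdd w)
    simpa [deriv_exp_const_mul] using congrArg (deriv · 0) hfun
  exact (linearIndependent_monoidHom (Multiplicative ℂ) ℂ).comp χ hχ

theorem coeff_eq_zero_of_sum_exp_eventually_eq_zero {ι : Type*} [Fintype ι] {μ k : ι → ℂ} {z : ℂ}
    (hμ : μ.Injective) (h : ∀ᶠ w in 𝓝 z, ∑ i, k i * Complex.exp (μ i * w) = 0) (i : ι) :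
    k i = 0 := by
  have hzero : (fun w => ∑ i, k i * Complex.exp (μ i * w)) = 0 :=
    AnalyticOnNhd.eq_of_eventuallyEq (𝕜 := ℂ) (fun w _ => Differentiable.analyticAt (by fun_prop) w)
      analyticOnNhd_const h
  refine Fintype.linearIndependent_iff.1 (linearIndependent_exp_mul.comp μ hμ) k ?_ i
  ext w
  simpa using congrFun hzero w

theorem eq_one_or_eq_neg_one_of_moebius_exp {a b c A B C D z : ℂ} (ha : a ≠ 0) (hc : c ≠ 0)
    (hdet : A * D - B * C ≠ 0)
    (h : ∀ᶠ w in 𝓝 z, C * Complex.exp (c * w) + D ≠ 0 ∧ Complex.exp (c * (a * w + b)) =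
      (A * Complex.exp (c * w) + B) / (C * Complex.exp (c * w) + D)) : a = 1 ∨ a = -1 := by
  by_contra! hne
  have hμ : ![c * (1 + a), c * a, c, 0].Injective := by
    have hsum : 1 + a ≠ 0 := fun h => hne.2 (by linear_combination h)
    intro i j hij
    fin_cases i <;> fin_cases j <;> simp_all [eq_comm]
  have hcoeff := coeff_eq_zero_of_sum_exp_eventually_eq_zero (z := z) hμ
    (k := ![Complex.exp (c * b) * C, Complex.exp (c * b) * D, -A, -B]) (by
      filter_upwards [h] with w hw
      obtain ⟨hw0, hw⟩ := hw
      rw [eq_div_iff hw0, mul_add c, Complex.exp_add, ← mul_assoc c] at hw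
      simp only [Fin.sum_univ_four, Matrix.cons_val]
      rw [mul_add c, mul_one, add_mul, Complex.exp_add, zero_mul, Complex.exp_zero]
      linear_combination hw)
  have hC : C = 0 := by simpa using hcoeff 0
  have hD : D = 0 := by simpa using hcoeff 1
  exact hdet (by rw [hC, hD]; ring)

theorem exists_mem_moebiusGroup_exp_iff {a b c : ℂ} (ha : a ≠ 0) (hc : c ≠ 0) (z : ℂ) :
    (∃ m ∈ moebiusGroup, ∀ᶠ w in 𝓝 z,
      (Complex.exp (c * (a * w + b)) : Sphere) = m (Complex.exp (c * w) : ℂ)) ↔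
      a = 1 ∨ a = -1 := by
  constructor
  · rintro ⟨m, hm, h⟩
    obtain ⟨A, B, C, D, hdet, hm⟩ := exists_coeff_of_mem_moebiusGroup hm
    exact eq_one_or_eq_neg_one_of_moebius_exp ha hc hdet (h.mono fun w hw => hm _ _ hw.symm)
  · rintro (rfl | rfl)
    · obtain ⟨m, hm, h⟩ := exists_mem_moebiusGroup_of_coeff (a := Complex.exp (c * b)) (b := 0)
        (c := 0) (d := 1) (by simp)
      refine ⟨m, hm, .of_forall fun w => ?_⟩
      rw [h _ (by simp), mul_add, Complex.exp_add]
      simp [mul_comm]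
    · obtain ⟨m, hm, h⟩ := exists_mem_moebiusGroup_of_coeff (a := 0) (b := Complex.exp (c * b))
        (c := 1) (d := 0) (by simp)
      refine ⟨m, hm, .of_forall fun w => ?_⟩
      rw [h _ (by simp), mul_add, Complex.exp_add]
      simp [Complex.exp_neg, div_eq_inv_mul]

end Exponentials

section RelativelyHurwitz

variable {τ : UpperHalfPlane}

theorem mem_moeb_ofDevelopingMap_iff {D : ℂ → ℂ} (hD : IsDevelopingMap affineGroup (proj τ) D)
    {f : Torus τ ≃ₜ Torus τ} {a b : ℂ} (hf : ∀ z, f (proj τ z) = proj τ (a * z + b)) :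
    f ∈ moeb (toProjective (affineStructureOfDevelopingMap hD)) ↔
      ∀ z, ∃ m ∈ moebiusGroup, ∀ᶠ w in 𝓝 z, (D (a * w + b) : Sphere) = m (D w : ℂ) := by
  rw [toProjective_ofDevelopingMap]
  exact GStructure.mem_aut_ofDevelopingMap_iff (by fun_prop) hf

theorem exists_affine_lift_of_mem_holAut {f : Torus τ ≃ₜ Torus τ} (hf : f ∈ holAut (Torus τ)) :
    ∃ u ∈ latticeUnits τ, ∃ b : ℂ, ∀ z, f (proj τ z) = proj τ (u * z + b) := by
  obtain ⟨a, b, h⟩ := exists_affine_lift hf.1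
  obtain ⟨u, hu, rfl⟩ := exists_latticeUnit_of_lift f.injective h
  exact ⟨u, hu, b, h⟩

theorem isRelativelyHurwitz_euclideanUniformization (τ : UpperHalfPlane) :
    IsRelativelyHurwitz (toProjective (euclideanUniformization τ)) := by
  refine (moeb_le_holAut (euclideanUniformization_mem_affineStructures τ)).antisymm fun f hf => ?_
  obtain ⟨u, -, b, h⟩ := exists_affine_lift_of_mem_holAut hf
  obtain ⟨m, hm, hub⟩ := exists_moebius_of_affine
    (g := (Equiv.mulLeft₀ (u : ℂ) u.ne_zero).trans (Equiv.addRight b))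
    ⟨u, b, u.ne_zero, fun _ => rfl⟩
  rw [euclideanUniformization_eq, mem_moeb_ofDevelopingMap_iff _ h]
  exact fun z => ⟨m, hm, .of_forall fun w => (hub w).symm⟩

theorem mem_moeb_exponentialStructure_iff {c u : ℂˣ} {b : ℂ} {f : Torus τ ≃ₜ Torus τ}
    (hf : ∀ z, f (proj τ z) = proj τ (u * z + b)) :
    f ∈ moeb (toProjective (exponentialStructure τ c)) ↔ u = 1 ∨ u = -1 := by
  rw [exponentialStructure, mem_moeb_ofDevelopingMap_iff _ hf, ← Units.val_eq_one,
    ← units_val_eq_neg_one_iff]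
  simp only [exists_mem_moebiusGroup_exp_iff u.ne_zero c.ne_zero, forall_const]

theorem isRelativelyHurwitz_exponentialStructure_iff {c : ℂˣ} :
    IsRelativelyHurwitz (toProjective (exponentialStructure τ c)) ↔
      ∀ u ∈ latticeUnits τ, u = 1 ∨ u = -1 := by
  constructor
  · intro h u hu
    obtain ⟨f, hf, hfu⟩ := exists_mem_holAut_of_mem_latticeUnits hu
    rw [← h] at hf
    exact (mem_moeb_exponentialStructure_iff (b := 0) (by simpa using hfu)).1 hf
  · refine fun h => (moeb_le_holAut (exponentialStructure_mem_affineStructures τ c)).antisymm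
      fun f hf => ?_
    obtain ⟨u, hu, b, hfu⟩ := exists_affine_lift_of_mem_holAut hf
    exact (mem_moeb_exponentialStructure_iff hfu).2 (h u hu)

theorem forall_isRelativelyHurwitz_eq_euclideanUniformization_iff :
    (∀ σ ∈ affineStructures (Torus τ), IsRelativelyHurwitz (toProjective σ) →
      σ = euclideanUniformization τ) ↔ ∃ u ∈ latticeUnits τ, u ≠ 1 ∧ u ≠ -1 := by
  constructor
  · intro h
    by_contra! hunits
    have hHurwitz : IsRelativelyHurwitz (toProjective (exponentialStructure τ 1)) :=
      isRelativelyHurwitz_exponentialStructure_iff.2 fun u hu =>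
        or_iff_not_imp_left.2 (hunits u hu)
    exact exponentialStructure_ne_euclideanUniformization τ 1 <|
      h _ (exponentialStructure_mem_affineStructures τ 1) hHurwitz
  · rintro ⟨u, hu, hu1, hu2⟩ σ hσ hHurwitz
    obtain rfl | ⟨c, rfl⟩ := eq_euclideanUniformization_or_eq_exponentialStructure hσ
    · rfl
    · exact ((isRelativelyHurwitz_exponentialStructure_iff.1 hHurwitz u hu).elim hu1 hu2).elim

end RelativelyHurwitz

end Unif

end

theorem mainTheorem6 (τ : UpperHalfPlane) :
    List.TFAE [
      -- the class of `τ` modulo `SL₂(ℤ)` is that of `exp (2πi/3)` or of `exp (iπ/2)`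
      ∃ γ : Matrix.SpecialLinearGroup (Fin 2) ℤ,
        ((γ • τ : UpperHalfPlane) : ℂ) = Complex.exp (2 * Real.pi * Complex.I / 3) ∨
        ((γ • τ : UpperHalfPlane) : ℂ) = Complex.exp (Complex.I * Real.pi / 2),
      -- the Euclidean uniformization is the unique relatively Hurwitz structure in `𝒜(X_τ)`
      Unif.euclideanUniformization τ ∈ Unif.affineStructures (Unif.Torus τ) ∧
        Unif.IsRelativelyHurwitz (Unif.toProjective (Unif.euclideanUniformization τ)) ∧
        ∀ σ ∈ Unif.affineStructures (Unif.Torus τ),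
          Unif.IsRelativelyHurwitz (Unif.toProjective σ) → σ = Unif.euclideanUniformization τ,
      -- `X_τ` has complex multiplication by an automorphism other than `z ↦ ± z`
      ∃ f ∈ Unif.holAut (Unif.Torus τ), ∃ a : ℂ, a ≠ 1 ∧ a ≠ -1 ∧
        ∀ z : ℂ, f (Unif.proj τ z) = Unif.proj τ (a * z)] := by
  tfae_have 1 ↔ 3 := by
    simp only [← Unif.coe_ρ_eq_exp, ← Unif.coe_I_eq_exp, UpperHalfPlane.coe_inj]
    rw [← Unif.isEllipticPoint_iff_exists_smul_eq,
      Unif.isEllipticPoint_iff_exists_latticeUnit,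
      Unif.exists_latticeUnit_iff_exists_mem_holAut]
  tfae_have 2 ↔ 3 := by
    rw [← Unif.exists_latticeUnit_iff_exists_mem_holAut,
      Unif.forall_isRelativelyHurwitz_eq_euclideanUniformization_iff,
      and_iff_right (Unif.euclideanUniformization_mem_affineStructures τ),
      and_iff_right (Unif.isRelativelyHurwitz_euclideanUniformization τ)]
  tfae_finish
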